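/- A hypothesis class is a set $H$ of functions $\mathbb{N}\to\{0,1\}$. A sample is a finite sequence $S=(x_1,y_1)\ldots(x_k,y_k)$ of pairs from $\mathbb{N}\times\{0,1\}$; it is $H$-realizable if some $f\in H$ satisfies $f(x_i)=y_i$ for $i=1,\ldots,k$. A Littlestone tree of depth $n$ is a complete rooted binary tree of depth $n$ in which every non-leaf node is labelled by a natural number and has one outgoing edge labelled $0$ and one outgoing edge labelled $1$. A leaf of the tree determines the sample formed by the pairs (node label, edge label) along the path from the root to this leaf, and the leaf is $H$-realizable if this sample is. The effective Littlestone dimension of $H$ is the minimal $d\ge 0$ for which there exists a total Turing machine that, given any Littlestone tree of depth $d+1$, outputs a leaf of this tree which is not $H$-realizable (it is infinite if there is no such $d$). **Corollary.** Let $H$ be a hypothesis class of effective Littlestone dimension $1$. Then $H$ has a total computable online learner with at most $1$ mistake. That is, there exists a total computable function $L\colon(\mathbb{N}\times\{0,1\})^*\times\mathbb{N}\to\{0,1\}$ such that for every $H$-realizable sample $(x_1,y_1)\ldots(x_k,y_k)$ there is at most one $i\in\{1,\ldots,k\}$ with $L\big((x_1,y_1)\ldots(x_{i-1},y_{i-1}),\,x_i\big)\ne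 y_i$. -/

import Mathlib

namespace OnlineLearning

/-- A hypothesis class: a set of functions from `ℕ` to `{0, 1}` (`false` is `0`, `true` is `1`). -/
abbrev HypothesisClass : Type := Set (ℕ → Bool)

/-- A sample: a finite sequence of pairs from `ℕ × {0, 1}`. -/
abbrev Sample : Type := List (ℕ × Bool)

/-- The sample `S` is consistent with the function `f`. -/
def Consistent (S : Sample) (f : ℕ → Bool) : Prop :=
  ∀ p ∈ S, f p.1 = p.2

/-- The sample `S` is `H`-realizable: some function of `H` is consistent with it. -/
def Realizable (H : HypothesisClass) (S : Sample) : Prop :=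
  ∃ f ∈ H, Consistent S f

/-- A learner: a partial function taking a sample and a natural number to a bit. -/
abbrev Learner : Type := Sample × ℕ →. Bool

/-- `L` is a learner for `H`: it is defined on every `H`-realizable sample and every number. -/
def IsLearnerFor (L : Learner) (H : HypothesisClass) : Prop :=
  ∀ S : Sample, Realizable H S → ∀ x : ℕ, (L (S, x)).Dom

/-- A total learner is defined everywhere. -/
def IsTotal (L : Learner) : Prop :=
  ∀ (S : Sample) (x : ℕ), (L (S, x)).Dom

/-- A learner is computable if some machine outputs `L (S, x)` where it is defined, and does not
halt where it is not defined. -/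
def IsComputableLearner (L : Learner) : Prop :=
  Partrec L

open Classical in
/-- The number of mistakes of `L` on the sample `S = (x₁, y₁) … (xₖ, yₖ)`: the number of indices `i`
such that `L ((x₁, y₁) … (xᵢ₋₁, yᵢ₋₁), xᵢ)` is not equal to `yᵢ`. -/
noncomputable def mistakes (L : Learner) (S : Sample) : ℕ :=
  (Finset.univ.filter fun i : Fin S.length =>
    L (S.take i, (S.get i).1) ≠ Part.some (S.get i).2).card

/-- `L` is an online learner for `H` with at most `d` mistakes. -/
def IsOnlineLearner (L : Learner) (H : HypothesisClass) (d : ℕ) : Prop :=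
  IsLearnerFor L H ∧ ∀ S : Sample, Realizable H S → mistakes L S ≤ d

/-- Littlestone trees of depth `n`, that is, complete binary trees of depth `n` with the non-leaf
nodes labelled by natural numbers. A tree of depth `n + 1` is a triple of the label of the root, the
subtree below the `0`-edge of the root and the subtree below the `1`-edge of the root. -/
def LittlestoneTree : ℕ → Type
  | 0 => Unit
  | n + 1 => ℕ × LittlestoneTree n × LittlestoneTree n

/-- The coding of Littlestone trees as inputs of machines (iterated pairing). -/
instance instPrimcodableLittlestoneTree : (n : ℕ) → Primcodable (LittlestoneTree n)
  | 0 => inferInstanceAs (Primcodable Unit)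
  | n + 1 =>
    letI := instPrimcodableLittlestoneTree n
    inferInstanceAs (Primcodable (ℕ × LittlestoneTree n × LittlestoneTree n))

/-- A leaf of a depth-`n` tree, given by the labels of the edges from the root to the leaf. -/
abbrev Leaf (n : ℕ) : Type := List.Vector Bool n

/-- The sample written on the path from the root of the tree to the given leaf. -/
def leafSample : {n : ℕ} → LittlestoneTree n → Leaf n → Sample
  | 0, _, _ => []
  | _ + 1, (x, T₀, T₁), v => (x, v.head) :: leafSample (if v.head then T₁ else T₀) v.tail

/-- There is a total machine that, given a Littlestone tree of depth `d + 1`, outputs some leaf of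
this tree which is not `H`-realizable. -/
def HasRefuter (H : HypothesisClass) (d : ℕ) : Prop :=
  ∃ A : LittlestoneTree (d + 1) → Leaf (d + 1),
    Computable A ∧ ∀ T : LittlestoneTree (d + 1), ¬ Realizable H (leafSample T (A T))

/-- The effective Littlestone dimension: the minimal `d` for which `HasRefuter H d` holds, and `⊤` if
there is no such `d`. -/
noncomputable def effectiveLittlestoneDim (H : HypothesisClass) : ℕ∞ :=
  sInf ((fun d : ℕ => (d : ℕ∞)) '' {d : ℕ | HasRefuter H d})

end OnlineLearning

/-!
A refuter for trees of depth two, applied to the tree with root `x`, `y` below the `0`-edge and `z`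
below the `1`-edge, forbids one of the four paths. A forbidden path is a pair of literals
(assertions `f x = b`) that never hold together, that is, an implication from either literal to the
opposite of the other. Closing these implications under composition, contraposition and ex falso
gives a recursively enumerable relation `Implies` on literals, sound for every function of the
class. Call a literal determining if it implies a value at every point. For each `x`, one of the
literals `(x, 0)`, `(x, 1)` is determining: otherwise there are `y` and `z` at which they imply no
value, and the path forbidden in the tree on `x`, `y`, `z` is a contradiction.

It therefore suffices to find a computable predictor `p` such that `(x, !p x)` is determining for
every `x`: the learner follows `p` until it has seen `p` err, and from then on searches for the
value implied by the first error. This search halts on every input, and its result is right on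
realizable samples.

If every literal is determining, any `p` will do. Otherwise the choice of `p x` is made effective
by building a finite amount of information into the predictor (`ImplicationSystem.exists_guess`): a
non-determining literal `a`, and a point `y` at which `a` implies no value. The opposite `¬a` is
determining, so it implies some `(x, b)`, and by the choice of `a`
(`ImplicationSystem.exists_pivot`) either `(x, ¬b)` is determining or `a` implies it.
* If `a` implies a literal `(x, c)`, then `(x, ¬c)` implies `¬a` and is determining.
* If `(x, ¬b)` is determining, it implies a value at `y`. Conversely, a literal `(x, ¬b)` with `¬a`
  implying `(x, b)` that implies a value at `y` is determining, for otherwise `a` would imply it,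
  and with it the value at `y`.
Both situations are recognized by an unbounded search, and one of them always occurs.
-/

namespace OnlineLearning

/-! ### Computability -/

section Search

variable {α β σ : Type*} [Primcodable α] [Primcodable β] [Primcodable σ]

/-- Mathlib has this for primitive recursive functions only. The fold is computed by recursion on
the position in the list. -/
theorem computable_list_foldl {f : α → List β} {g : α → σ} {h : σ → β → σ}
    (hf : Computable f) (hg : Computable g) (hh : Computable₂ h) :
    Computable fun a => (f a).foldl h (g a) := by
  have key : ∀ (l : List β) (s : σ) (n : ℕ),
      (n.rec s fun k r => Option.casesOn (l[k]?) r fun t => h r t : σ) =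
        (l.take n).foldl h s := by
    intro l s n
    induction n with
    | zero => simp
    | succ n ih =>
      rw [List.take_add_one, List.foldl_append, ← ih]
      change (Option.casesOn (l[n]?) _ _ : σ) = _
      cases l[n]? <;> rfl
  have step : Computable₂ fun (a : α) (q : ℕ × σ) =>
      (Option.casesOn ((f a)[q.1]?) q.2 fun t => h q.2 t : σ) :=
    Computable.option_casesOn
      (Computable.list_getElem?.comp (hf.comp Computable.fst)
        (Computable.fst.comp Computable.snd))
      (Computable.snd.comp Computable.snd)
      (hh.comp (Computable.snd.comp (Computable.snd.comp Computable.fst)) Computable.snd)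
  refine (Computable.nat_rec (Computable.list_length.comp hf) hg step).of_eq fun a => ?_
  exact (key _ _ _).trans (by rw [List.take_length])

/-- A total unbounded search over `ℕ` finds the least witness computably. -/
theorem exists_computable_min {P : α → ℕ → Bool} (hP : Computable₂ P) (h : ∀ a, ∃ n, P a n = true) :
    ∃ F : α → ℕ, Computable F ∧ ∀ a, P a (F a) = true ∧ ∀ m < F a, P a m = false := by
  refine ⟨fun a => Nat.find (h a), ?_, fun a => ⟨Nat.find_spec (h a), fun m hm => by
    simpa using Nat.find_min (h a) hm⟩⟩
  refine (Partrec.rfind (p := fun a n => Part.some (P a n)) hP.partrec₂).of_eq fun a => ?_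
  refine Part.eq_some_iff.2 (Nat.mem_rfind.2 ⟨?_, fun {m} hm => ?_⟩)
  · exact Part.mem_some_iff.2 (Nat.find_spec (h a)).symm
  · exact Part.mem_some_iff.2 (Bool.eq_false_of_not_eq_true (Nat.find_min (h a) hm)).symm

/-- A total unbounded search over a coded type finds some witness computably. -/
theorem exists_computable_search {P : α → β → Bool} (hP : Computable₂ P)
    (h : ∀ a, ∃ b, P a b = true) :
    ∃ F : α → β, Computable F ∧ ∀ a, P a (F a) = true := by
  choose w hw using h
  let Q : α → ℕ → Option β := fun a n =>
    (Encodable.decode (α := β) n).bind fun b => bif P a b then some b else none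
  have hQ : Computable₂ Q :=
    Computable.option_bind (Computable.decode.comp Computable.snd)
      (Computable.cond (hP.comp (Computable.fst.comp Computable.fst) Computable.snd)
        (Computable.option_some.comp Computable.snd) (Computable.const none))
  have hdom : ∀ a, (Nat.rfindOpt (Q a)).Dom := fun a =>
    Nat.rfindOpt_dom.2 ⟨Encodable.encode (w a), w a, by simp [Q, hw]⟩
  refine ⟨fun a => (Nat.rfindOpt (Q a)).get (hdom a), ?_, fun a => ?_⟩
  · exact (Partrec.rfindOpt hQ).of_eq fun a => (Part.some_get (hdom a)).symm
  · obtain ⟨n, hn⟩ := Nat.rfindOpt_spec (Part.get_mem (hdom a))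
    simp only [Q, Option.mem_def, Option.bind_eq_some_iff] at hn
    obtain ⟨b, -, hb⟩ := hn
    cases hPb : P a b <;> simp [hPb] at hb
    rwa [hb] at hPb

theorem computable_decide_eq [DecidableEq α] : Computable₂ fun a b : α => decide (a = b) :=
  (Primrec.eq (α := α)).decide.to_comp

end Search

/-! ### Reachability along a computable family of edges -/

section Reach

variable {α T : Type*} [DecidableEq α]

/-- The endpoint of the walk that starts at `a` and reads the edges `src t → tgt t` of a list,
staying where it is at an edge that does not start at the current vertex. -/
def follow (src tgt : T → α) (l : List T) (a : α) : α :=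
  l.foldl (fun s t => bif decide (src t = s) then tgt t else s) a

/-- There is an edge from `a` to `b`. -/
def Edge (src tgt : T → α) (a b : α) : Prop :=
  ∃ t, src t = a ∧ tgt t = b

theorem reflTransGen_edge_iff {src tgt : T → α} {a b : α} :
    Relation.ReflTransGen (Edge src tgt) a b ↔ ∃ l, follow src tgt l a = b := by
  constructor
  · intro h
    induction h with
    | refl => exact ⟨[], rfl⟩
    | tail _ h ih =>
      obtain ⟨l, hl⟩ := ih
      obtain ⟨t, ht, rfl⟩ := h
      refine ⟨l ++ [t], ?_⟩
      unfold follow at hl ⊢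
      simp [hl, ht]
  · rintro ⟨l, rfl⟩
    induction l generalizing a with
    | nil => exact .refl
    | cons t l ih =>
      by_cases h : src t = a
      · refine Relation.ReflTransGen.head ⟨t, h, rfl⟩ ?_
        simpa [follow, h] using ih (a := tgt t)
      · simpa [follow, h] using ih (a := a)

theorem computable_follow [Primcodable α] [Primcodable T] {src tgt : T → α}
    (hs : Computable src) (ht : Computable tgt) : Computable₂ (follow src tgt) :=
  computable_list_foldl Computable.fst Computable.snd
    (Computable.cond
      (computable_decide_eq.comp (hs.comp Computable.snd) Computable.fst)
      (ht.comp Computable.snd) Computable.fst)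

end Reach

/-! ### Literals and implications between them -/

/-- The literal `(x, b)` stands for the assertion that the unknown function takes the value `b`
at `x`. -/
abbrev Literal : Type := ℕ × Bool

/-- The opposite literal. -/
def Literal.neg (a : Literal) : Literal := (a.1, !a.2)

@[simp] theorem Literal.neg_neg (a : Literal) : a.neg.neg = a := by simp [Literal.neg]

theorem Literal.computable_neg : Computable Literal.neg :=
  Computable.fst.pair (Primrec.not.to_comp.comp Computable.snd)

/-- The literal `a` holds for the function `f`. -/
def Literal.Holds (f : ℕ → Bool) (a : Literal) : Prop := f a.1 = a.2

theorem Literal.holds_neg {f : ℕ → Bool} {a : Literal} : a.neg.Holds f ↔ ¬ a.Holds f := by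
  simp only [Literal.Holds, Literal.neg]
  cases f a.1 <;> cases a.2 <;> simp

/-- Under the implications `R`, the literal `a` determines the value of the unknown function at
every point. -/
def Determines (R : Literal → Literal → Prop) (a : Literal) : Prop :=
  ∀ y, ∃ c, R a (y, c)

/-- A relation that behaves like implication between literals and is recursively enumerable: `chk`
checks certificates, which are taken from the type `W`. The last field is what a refuter for trees
of depth two provides: at every point, one of the two literals is determining. -/
structure ImplicationSystem (R : Literal → Literal → Prop) (W : Type) [Primcodable W] : Prop where
  trans : ∀ {a b c}, R a b → R b c → R a c
  contra : ∀ {a b}, R a b → R b.neg a.neg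
  exFalso : ∀ {a}, R a a.neg → ∀ b, R a b
  cert : ∃ chk : Literal × Literal → W → Bool,
    Computable₂ chk ∧ ∀ a b, R a b ↔ ∃ w, chk (a, b) w = true
  total : ∀ x, ∃ b, Determines R (x, b)

/-! ### The predictor and the learner -/

section Guess

variable {R : Literal → Literal → Prop} {W : Type} [Primcodable W]

theorem ImplicationSystem.determines_or (hR : ImplicationSystem R W) (a : Literal) :
    Determines R a ∨ Determines R a.neg := by
  obtain ⟨x, b⟩ := a
  obtain ⟨c, hc⟩ := hR.total x
  rcases Bool.eq_or_eq_not c b with h | h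
  · exact .inl (h ▸ hc)
  · exact .inr (by rwa [h] at hc)

theorem ImplicationSystem.determines_of_imp (hR : ImplicationSystem R W) {a b : Literal}
    (h : R a b) (hb : Determines R b) : Determines R a := fun y =>
  (hb y).imp fun _ hc => hR.trans h hc

/-- If some literal is not determining, then there is such a literal `a` which implies every
non-determining `b` with `R a.neg b.neg`. The right choice is a literal that is not implied by its
own opposite, if there is one; otherwise any non-determining literal will do. -/
theorem ImplicationSystem.exists_pivot (hR : ImplicationSystem R W)
    (h : ∃ a, ¬ Determines R a) :
    ∃ a, ¬ Determines R a ∧ ∀ b, ¬ Determines R b → R a.neg b.neg → R a b := by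
  obtain ⟨a, ha, hforced⟩ :
      ∃ a, ¬ Determines R a ∧ (R a.neg a → ∀ b, ¬ Determines R b → R b.neg b) := by
    by_cases h' : ∃ a, ¬ Determines R a ∧ ¬ R a.neg a
    · obtain ⟨a, ha, hn⟩ := h'
      exact ⟨a, ha, fun h => absurd h hn⟩
    · push Not at h'
      obtain ⟨a, ha⟩ := h
      exact ⟨a, ha, fun _ => h'⟩
  refine ⟨a, ha, fun b hb hab => ?_⟩
  -- `b.neg` is determining, so it implies `a` or `a.neg`
  obtain ⟨c, hc⟩ := (hR.determines_or b).resolve_left hb a.1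
  rcases Bool.eq_or_eq_not c a.2 with h | h
  · have hc' : R b.neg a := by rw [h] at hc; exact hc
    -- `a.neg` implies `a`, so `b.neg` implies `b`, and then everything implies `b`
    have hbb := hforced (hR.trans hab hc') b hb
    have := hR.contra (hR.exFalso (a := b.neg) (by simpa using hbb) a.neg)
    simpa using this
  · have hc' : R b.neg a.neg := by rw [h] at hc; exact hc
    simpa using hR.contra hc'

/-- There is a computable predictor `p` such that seeing `p` err once reveals the whole function.
The definition of determining gives no procedure that decides it, so the predictor has finitely
much information built in: the literal `a` of `exists_pivot` and a point `y` whose value `a` does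
not determine. It searches for a bit `b` such that `a` implies `(x, b)`, or such that `a.neg`
implies `(x, b)` and `(x, !b)` decides the value at `y`. -/
theorem ImplicationSystem.exists_guess (hR : ImplicationSystem R W) :
    ∃ p : ℕ → Bool, Computable p ∧ ∀ x, Determines R (x, !p x) := by
  by_cases h : ∃ a, ¬ Determines R a
  swap
  · push Not at h
    exact ⟨fun _ => false, Computable.const _, fun x => h _⟩
  obtain ⟨a, ha, hpiv⟩ := hR.exists_pivot h
  have hna := (hR.determines_or a).resolve_left ha
  obtain ⟨y, hy⟩ : ∃ y, ∀ c, ¬ R a (y, c) := by simpa [Determines] using ha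
  obtain ⟨chk, hchk, hiff⟩ := hR.cert
  let P : ℕ → Bool × Bool × W × W → Bool := fun x w =>
    chk (a, (x, w.1)) w.2.2.1 ||
      (chk (a.neg, (x, w.1)) w.2.2.1 && chk ((x, !w.1), (y, w.2.1)) w.2.2.2)
  have hP : Computable₂ P := by
    have hx : Computable fun q : ℕ × Bool × Bool × W × W => (q.1, q.2.1) :=
      Computable.fst.pair (Computable.fst.comp Computable.snd)
    have hc : Computable fun q : ℕ × Bool × Bool × W × W => q.2.2.1 :=
      Computable.fst.comp (Computable.snd.comp Computable.snd)
    have hw : Computable fun q : ℕ × Bool × Bool × W × W => q.2.2.2 :=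
      Computable.snd.comp (Computable.snd.comp Computable.snd)
    exact Primrec.or.to_comp.comp
      (hchk.comp ((Computable.const a).pair hx) (Computable.fst.comp hw))
      (Primrec.and.to_comp.comp
        (hchk.comp ((Computable.const a.neg).pair hx) (Computable.fst.comp hw))
        (hchk.comp ((Literal.computable_neg.comp hx).pair ((Computable.const y).pair hc))
          (Computable.snd.comp hw)))
  have hPspec : ∀ x b, (∃ w, P x (b, w) = true) ↔
      R a (x, b) ∨ R a.neg (x, b) ∧ ∃ c, R (x, !b) (y, c) := by
    intro x b
    simp only [P, Bool.or_eq_true, Bool.and_eq_true, hiff, Prod.exists]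
    constructor
    · rintro ⟨c, w, w', h | ⟨h, h'⟩⟩
      · exact .inl ⟨w, h⟩
      · exact .inr ⟨⟨w, h⟩, c, w', h'⟩
    · rintro (⟨w, h⟩ | ⟨⟨w, h⟩, c, w', h'⟩)
      · exact ⟨false, w, w, .inl h⟩
      · exact ⟨c, w, w', .inr ⟨h, h'⟩⟩
  obtain ⟨F, hF, hPF⟩ := exists_computable_search hP fun x => by
    obtain ⟨b, hb⟩ := hna x
    by_cases hd : Determines R (x, !b)
    · obtain ⟨w, hw⟩ := (hPspec x b).2 (.inr ⟨hb, hd y⟩)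
      exact ⟨_, hw⟩
    · -- the pivot property provides the other kind of certificate, for the opposite bit
      have := hpiv (x, !b) hd (by simpa [Literal.neg] using hb)
      obtain ⟨w, hw⟩ := (hPspec x (!b)).2 (.inl this)
      exact ⟨_, hw⟩
  refine ⟨fun x => (F x).1, Computable.fst.comp hF, fun x => ?_⟩
  rcases (hPspec x (F x).1).1 ⟨(F x).2, hPF x⟩ with h | ⟨h, c, hc⟩
  · exact hR.determines_of_imp (by simpa [Literal.neg] using hR.contra h) hna
  · by_contra hd
    -- the pivot `a` would imply `(x, !b)` and hence decide the value at `y`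
    exact hy c (hR.trans (hpiv _ hd (by simpa [Literal.neg] using h)) hc)

/-- For a computable predictor `p`, the position of the first example of a sample on which `p` is
wrong is computable; it is beyond the end of the sample if there is no such example. -/
theorem exists_computable_firstError {p : ℕ → Bool} (hp : Computable p) :
    ∃ N : Sample → ℕ, Computable N ∧ ∀ S,
      (∀ q, S[N S]? = some q → q.2 = !p q.1) ∧
        ∀ m < N S, ∀ q, S[m]? = some q → q.2 ≠ !p q.1 := by
  let P : Sample → ℕ → Bool := fun S n =>
    Option.casesOn (S[n]?) true fun q => decide (q.2 = !p q.1)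
  have herr : Computable₂ fun (_ : Sample × ℕ) (q : ℕ × Bool) => decide (q.2 = !p q.1) :=
    computable_decide_eq.comp (Computable.snd.comp Computable.snd)
      (Primrec.not.to_comp.comp (hp.comp (Computable.fst.comp Computable.snd)))
  have hP : Computable₂ P :=
    Computable.option_casesOn Computable.list_getElem? (Computable.const true) herr
  obtain ⟨N, hN, hspec⟩ := exists_computable_min hP fun S => ⟨S.length, by simp [P]⟩
  refine ⟨N, hN, fun S => ⟨fun q hq => ?_, fun m hm q hq => ?_⟩⟩
  · have := (hspec S).1
    simpa only [P, hq, decide_eq_true_eq] using this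
  · have := (hspec S).2 m hm
    simpa only [P, hq, decide_eq_false_iff_not] using this

/-- The learner predicts according to `p` until it sees an example on which `p` is wrong; from then
on it predicts what the first such example implies. -/
theorem ImplicationSystem.exists_learner (hR : ImplicationSystem R W) {H : HypothesisClass}
    (hs : ∀ f ∈ H, ∀ a b : Literal, R a b → a.Holds f → b.Holds f) :
    ∃ L : Learner, IsTotal L ∧ IsComputableLearner L ∧ IsOnlineLearner L H 1 := by
  obtain ⟨p, hp, hdet⟩ := hR.exists_guess
  obtain ⟨chk, hchk, hiff⟩ := hR.cert
  obtain ⟨N, hN, hNspec⟩ := exists_computable_firstError hp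
  let P : Sample × ℕ → Bool × W → Bool := fun q w =>
    Option.casesOn (q.1[N q.1]?) (decide (w.1 = p q.2)) fun a => chk (a, (q.2, w.1)) w.2
  have hP : Computable₂ P := by
    have hx : Computable fun q : (Sample × ℕ) × (Bool × W) => q.1.2 :=
      Computable.snd.comp Computable.fst
    have hc : Computable fun q : (Sample × ℕ) × (Bool × W) => q.2.1 :=
      Computable.fst.comp Computable.snd
    have ho : Computable fun q : (Sample × ℕ) × (Bool × W) => q.1.1[N q.1.1]? :=
      Computable.list_getElem?.comp (Computable.fst.comp Computable.fst)
        (hN.comp (Computable.fst.comp Computable.fst))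
    have hk : Computable₂ fun (q : (Sample × ℕ) × (Bool × W)) (a : Literal) =>
        chk (a, (q.1.2, q.2.1)) q.2.2 :=
      hchk.comp (Computable.snd.pair ((hx.pair hc).comp Computable.fst))
        (Computable.snd.comp (Computable.snd.comp Computable.fst))
    exact Computable.option_casesOn ho (computable_decide_eq.comp hc (hp.comp hx)) hk
  obtain ⟨F, hF, hFspec⟩ := exists_computable_search hP fun q => by
    rcases hq : q.1[N q.1]? with _ | ⟨x, b⟩
    · -- the certificate is irrelevant here, so any one will do
      obtain ⟨c, hc⟩ := hdet 0 0
      obtain ⟨w, -⟩ := (hiff _ _).1 hc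
      exact ⟨(p q.2, w), by simp [P, hq]⟩
    · obtain rfl : b = !p x := (hNspec q.1).1 _ hq
      obtain ⟨c, hc⟩ := hdet x q.2
      obtain ⟨w, hw⟩ := (hiff _ _).1 hc
      exact ⟨(c, w), by simpa only [P, hq] using hw⟩
  refine ⟨fun q => Part.some (F q).1, fun _ _ => trivial,
    (Computable.fst.comp hF).partrec, fun _ _ _ => trivial, fun S ⟨f, hfH, hf⟩ => ?_⟩
  -- a mistake can only be made while `p` is right on all previous examples
  have key : ∀ i : Fin S.length, Part.some (F (S.take i, (S.get i).1)).1 ≠ Part.some (S.get i).2 →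
      i ≤ N (S.take i) ∧ (S.get i).2 = !p (S.get i).1 := by
    intro i hi
    have hi' : (F (S.take i, (S.get i).1)).1 ≠ (S.get i).2 := fun h => hi (congrArg _ h)
    have hspec := hFspec (S.take i, (S.get i).1)
    rcases hq : (S.take i)[N (S.take i)]? with _ | a
    · simp only [P, hq, decide_eq_true_eq] at hspec
      refine ⟨?_, ?_⟩
      · simpa [i.2.le] using List.getElem?_eq_none_iff.1 hq
      · rw [hspec] at hi'
        exact Bool.eq_not.2 hi'.symm
    · simp only [P, hq] at hspec
      have ha : a ∈ S := List.mem_of_mem_take (List.mem_of_getElem? hq)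
      have h := hs f hfH _ _ ((hiff _ _).2 ⟨_, hspec⟩) (hf a ha)
      exact absurd (h.symm.trans (hf (S.get i) (S.get_mem i))) hi'
  have hlt : ∀ i j : Fin S.length, i < j →
      Part.some (F (S.take i, (S.get i).1)).1 ≠ Part.some (S.get i).2 →
      Part.some (F (S.take j, (S.get j).1)).1 = Part.some (S.get j).2 := by
    intro i j hij hi
    by_contra hj
    have hget : (S.take j)[(i : ℕ)]? = some (S.get i) := by
      rw [List.getElem?_take_of_lt hij]; simp
    exact (hNspec (S.take j)).2 i (lt_of_lt_of_le hij (key j hj).1) _ hget (key i hi).2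
  classical
  unfold mistakes
  refine Finset.card_le_one.2 fun i hi j hj => ?_
  simp only [Finset.mem_filter, Finset.mem_univ, true_and] at hi hj
  rcases lt_trichotomy i j with h | h | h
  · exact absurd (hlt i j h hi) hj
  · exact h
  · exact absurd (hlt j i h hj) hi

end Guess
/-! ### Implications obtained from forbidden pairs -/

section Forbidden

variable {T : Type}

/-- The source of the edge given by a forbidden pair `r t` of literals `a`, `b` and a flag: such a
pair yields the two edges `a → b.neg` and `b → a.neg`. -/
def edgeSrc (r : T → Literal × Literal) (t : Bool × T) : Literal :=
  bif t.1 then (r t.2).1 else (r t.2).2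

/-- The target of the edge given by a forbidden pair of literals and a flag. -/
def edgeTgt (r : T → Literal × Literal) (t : Bool × T) : Literal :=
  bif t.1 then (r t.2).2.neg else (r t.2).1.neg

/-- Derivability by walks along the edges. -/
def Derives (r : T → Literal × Literal) : Literal → Literal → Prop :=
  Relation.ReflTransGen (Edge (edgeSrc r) (edgeTgt r))

/-- Implication between literals under the forbidden pairs `r`: either `b` is derivable from `a`,
or one of `a`, `b.neg` is refuted by deriving its opposite. -/
def Implies (r : T → Literal × Literal) (a b : Literal) : Prop :=
  Derives r a b ∨ Derives r a a.neg ∨ Derives r b.neg b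

variable {r : T → Literal × Literal}

theorem Derives.contra {a b : Literal} (h : Derives r a b) : Derives r b.neg a.neg := by
  induction h with
  | refl => exact .refl
  | tail _ h ih =>
    obtain ⟨⟨k, t⟩, rfl, rfl⟩ := h
    exact Relation.ReflTransGen.head ⟨(!k, t), by cases k <;> simp [edgeSrc, edgeTgt]⟩ ih

theorem Derives.sound {f : ℕ → Bool} (hf : ∀ t, ¬ ((r t).1.Holds f ∧ (r t).2.Holds f))
    {a b : Literal} (h : Derives r a b) (ha : a.Holds f) : b.Holds f := by
  induction h with
  | refl => exact ha
  | tail _ h ih =>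
    obtain ⟨⟨k, t⟩, rfl, rfl⟩ := h
    have := hf t
    cases k <;> simp only [edgeSrc, edgeTgt, cond_true, cond_false, Literal.holds_neg] at ih ⊢ <;>
      tauto

theorem Implies.sound {f : ℕ → Bool} (hf : ∀ t, ¬ ((r t).1.Holds f ∧ (r t).2.Holds f))
    {a b : Literal} (h : Implies r a b) (ha : a.Holds f) : b.Holds f := by
  rcases h with h | h | h
  · exact h.sound hf ha
  · exact absurd ha (Literal.holds_neg.1 (h.sound hf ha))
  · by_contra hb
    exact hb (h.sound hf (Literal.holds_neg.2 hb))

/-- Transitivity needs some function to respect the forbidden pairs: otherwise a literal and its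
opposite might both be refuted. -/
theorem Implies.trans {f : ℕ → Bool} (hf : ∀ t, ¬ ((r t).1.Holds f ∧ (r t).2.Holds f))
    {a b c : Literal} (hab : Implies r a b) (hbc : Implies r b c) : Implies r a c := by
  rcases hab with hab | hab | hab
  · rcases hbc with hbc | hbc | hbc
    · exact .inl (Relation.ReflTransGen.trans hab hbc)
    · exact .inr (.inl ((Relation.ReflTransGen.trans hab hbc).trans hab.contra))
    · exact .inr (.inr hbc)
  · exact .inr (.inl hab)
  · rcases hbc with hbc | hbc | hbc
    · exact .inr (.inr ((Relation.ReflTransGen.trans hbc.contra hab).trans hbc))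
    · have hb : b.Holds f := Implies.sound hf (.inr (.inr hab)) (a := (0, f 0)) rfl
      exact absurd hb (Literal.holds_neg.1 (hbc.sound hf hb))
    · exact .inr (.inr hbc)

theorem computable_edgeSrc [Primcodable T] (hr : Computable r) : Computable (edgeSrc r) :=
  Computable.cond Computable.fst (Computable.fst.comp (hr.comp Computable.snd))
    (Computable.snd.comp (hr.comp Computable.snd))

theorem computable_edgeTgt [Primcodable T] (hr : Computable r) : Computable (edgeTgt r) :=
  Computable.cond Computable.fst
    (Literal.computable_neg.comp (Computable.snd.comp (hr.comp Computable.snd)))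
    (Literal.computable_neg.comp (Computable.fst.comp (hr.comp Computable.snd)))

/-- If the forbidden pairs include a root-to-leaf path of every tree of depth two, then the
implications they yield make one of the two literals at every point determining. -/
theorem Implies.implicationSystem [Primcodable T] (hr : Computable r) {f : ℕ → Bool}
    (hf : ∀ t, ¬ ((r t).1.Holds f ∧ (r t).2.Holds f))
    (htree : ∀ x y z, ∃ t b c, r t = ((x, b), (bif b then z else y, c))) :
    ImplicationSystem (Implies r) (List (Bool × T)) where
  trans := Implies.trans hf
  contra := by
    rintro a b (h | h | h)
    · exact .inl h.contra
    · exact .inr (.inr (by simpa using h))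
    · exact .inr (.inl (by simpa using h))
  exFalso := by
    rintro a (h | h | h) b
    · exact .inr (.inl h)
    · exact .inr (.inl h)
    · exact .inr (.inl (by simpa using h))
  cert := by
    let go := follow (edgeSrc r) (edgeTgt r)
    have hgo : Computable₂ go := computable_follow (computable_edgeSrc hr) (computable_edgeTgt hr)
    refine ⟨fun q l => decide (go l q.1 = q.2) || (decide (go l q.1 = q.1.neg) ||
      decide (go l q.2.neg = q.2)), ?_, fun a b => ?_⟩
    · have h1 : Computable fun q : (Literal × Literal) × List (Bool × T) => q.1.1 :=
        Computable.fst.comp Computable.fst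
      have h2 : Computable fun q : (Literal × Literal) × List (Bool × T) => q.1.2 :=
        Computable.snd.comp Computable.fst
      have h3 : Computable fun q : (Literal × Literal) × List (Bool × T) => go q.2 q.1.1 :=
        hgo.comp Computable.snd h1
      exact Primrec.or.to_comp.comp (computable_decide_eq.comp h3 h2)
        (Primrec.or.to_comp.comp
          (computable_decide_eq.comp h3 (Literal.computable_neg.comp h1))
          (computable_decide_eq.comp
            (hgo.comp Computable.snd (Literal.computable_neg.comp h2)) h2))
    · simp only [Implies, Derives, reflTransGen_edge_iff, Bool.or_eq_true, decide_eq_true_eq,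
        exists_or, go]
  total x := by
    by_contra! h
    have h0 := h false
    have h1 := h true
    simp only [Determines, not_forall, not_exists] at h0 h1
    obtain ⟨y, hy⟩ := h0
    obtain ⟨z, hz⟩ := h1
    obtain ⟨t, b, c, ht⟩ := htree x y z
    have he : Edge (edgeSrc r) (edgeTgt r) (x, b) (bif b then z else y, !c) :=
      ⟨(true, t), by simp [edgeSrc, ht], by simp [edgeTgt, ht, Literal.neg]⟩
    cases b
    · exact hy _ (.inl (.single he))
    · exact hz _ (.inl (.single he))

end Forbidden

/-! ### Refuters for trees of depth two -/

/-- The tree of depth `2` with the label `q.1` at the root, `q.2.1` below its `0`-edge and `q.2.2`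
below its `1`-edge. -/
def depthTwoTree (q : ℕ × ℕ × ℕ) : LittlestoneTree 2 :=
  (q.1, (q.2.1, (), ()), (q.2.2, (), ()))

theorem computable_depthTwoTree : Computable depthTwoTree := by
  have hu : Primrec fun _ : ℕ × ℕ × ℕ => ((), ()) := Primrec.const _
  have h : Primrec fun q : ℕ × ℕ × ℕ =>
      ((q.1, (q.2.1, (), ()), (q.2.2, (), ())) :
        ℕ × (ℕ × Unit × Unit) × (ℕ × Unit × Unit)) :=
    Primrec.fst.pair (((Primrec.fst.comp Primrec.snd).pair hu).pair
      ((Primrec.snd.comp Primrec.snd).pair hu))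
  exact h.to_comp

/-- The two literals on the path to the leaf chosen by a refuter for trees of depth `2`. -/
def refutedPair (A : LittlestoneTree 2 → Leaf 2) (q : ℕ × ℕ × ℕ) : Literal × Literal :=
  ((q.1, (A (depthTwoTree q)).head),
    (bif (A (depthTwoTree q)).head then q.2.2 else q.2.1, (A (depthTwoTree q)).tail.head))

theorem leafSample_depthTwoTree (A : LittlestoneTree 2 → Leaf 2) (q : ℕ × ℕ × ℕ) :
    leafSample (depthTwoTree q) (A (depthTwoTree q)) =
      [(refutedPair A q).1, (refutedPair A q).2] := by
  unfold refutedPair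
  generalize A (depthTwoTree q) = v
  simp only [depthTwoTree, leafSample]
  cases v.head <;> rfl

theorem computable_refutedPair {A : LittlestoneTree 2 → Leaf 2} (hA : Computable A) :
    Computable (refutedPair A) := by
  have hv : Computable fun q => A (depthTwoTree q) := hA.comp computable_depthTwoTree
  have hh : Computable fun q => (A (depthTwoTree q)).head := Computable.vector_head.comp hv
  exact (Computable.fst.pair hh).pair
    ((Computable.cond hh (Computable.snd.comp Computable.snd)
      (Computable.fst.comp Computable.snd)).pair
      (Computable.vector_head.comp (Computable.vector_tail.comp hv)))

/-- A refuter for trees of depth two yields a learner with at most one mistake. -/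
theorem HasRefuter.exists_learner {H : HypothesisClass} (h : HasRefuter H 1) :
    ∃ L : Learner, IsTotal L ∧ IsComputableLearner L ∧ IsOnlineLearner L H 1 := by
  obtain ⟨A, hA, hAH⟩ := h
  have hforb : ∀ f ∈ H, ∀ q,
      ¬ ((refutedPair A q).1.Holds f ∧ (refutedPair A q).2.Holds f) := by
    rintro f hf q ⟨h1, h2⟩
    refine hAH (depthTwoTree q) ⟨f, hf, ?_⟩
    rw [leafSample_depthTwoTree]
    simpa [Consistent] using ⟨h1, h2⟩
  rcases H.eq_empty_or_nonempty with rfl | ⟨f, hf⟩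
  · -- no sample is realizable
    exact ⟨fun _ => Part.some false, fun _ _ => trivial, (Computable.const false).partrec,
      fun _ _ _ => trivial, fun _ ⟨_, h, _⟩ => absurd h (Set.notMem_empty _)⟩
  · exact (Implies.implicationSystem (computable_refutedPair hA) (hforb f hf)
      fun x y z => ⟨(x, y, z), _, _, rfl⟩).exists_learner
      fun g hg _ _ hab => hab.sound (hforb g hg)

theorem hasRefuter_of_effectiveLittlestoneDim_eq {H : HypothesisClass} {d : ℕ}
    (h : effectiveLittlestoneDim H = d) : HasRefuter H d := by
  have hne : ((fun d : ℕ => (d : ℕ∞)) '' {d : ℕ | HasRefuter H d}).Nonempty := by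
    by_contra hn
    rw [Set.not_nonempty_iff_eq_empty] at hn
    simp [effectiveLittlestoneDim, hn] at h
  obtain ⟨e, he, hed⟩ := csInf_mem hne
  have : (e : ℕ∞) = d := hed.trans h
  have : e = d := by exact_mod_cast this
  exact this ▸ he

end OnlineLearning

theorem mainTheorem3 (H : OnlineLearning.HypothesisClass)
    (hH : OnlineLearning.effectiveLittlestoneDim H = 1) :
    ∃ L : OnlineLearning.Learner,
      OnlineLearning.IsTotal L ∧ OnlineLearning.IsComputableLearner L ∧
        OnlineLearning.IsOnlineLearner L H 1 :=
  (OnlineLearning.hasRefuter_of_effectiveLittlestoneDim_eq (d := 1)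
    (by exact_mod_cast hH)).exists_learner
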